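/- Let $X$ be a standard Borel space and $\mu$ a non-atomic Borel probability measure on $X$. Let $G_{\mathrm{mp}}(X,\mu)$ be the group, under composition, of all Borel bijections $f:X\to X$ that are measure preserving, i.e. $\mu(f^{-1}(A))=\mu(A)$ for all Borel $A\subseteq X$. Let $I_{\mathrm{mp}}(X,\mu)$ be its normal subgroup of all $f\in G_{\mathrm{mp}}(X,\mu)$ with $f(x)=x$ for $\mu$-almost every $x$. Let $\mathrm{Aut}(X,\mu)=G_{\mathrm{mp}}(X,\mu)/I_{\mathrm{mp}}(X,\mu)$, with canonical homomorphism $\bar\varphi:G_{\mathrm{mp}}(X,\mu)\to\mathrm{Aut}(X,\mu)$. Assume the Continuum Hypothesis, $2^{\aleph_0}=\aleph_1$. Then there is a group homomorphism $h:\mathrm{Aut}(X,\mu)\to G_{\mathrm{mp}}(X,\mu)$ such that $\bar\varphi\circ h=\mathrm{id}_{\mathrm{Aut}(X,\mu)}$. -/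

import Mathlib

open MeasureTheory

/-- The group `G_mp(X, μ)` of measure preserving Borel bijections of a standard Borel space
with a measure, under composition. (By the Lusin-Souslin theorem the inverse of a Borel bijection
of a standard Borel space is again Borel, so this is indeed a group.) -/
def Gmp {X : Type*} [MeasurableSpace X] [StandardBorelSpace X] (μ : Measure X) :
    Subgroup (Equiv.Perm X) where
  carrier := {f | MeasurePreserving f μ μ}
  mul_mem' := by
    intro f g hf hg
    exact MeasurePreserving.comp (g := ⇑f) (f := ⇑g) hf hg
  one_mem' := MeasurePreserving.id μ
  inv_mem' := by
    intro f hf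
    have hf' : MeasurePreserving f μ μ := hf
    let e : X ≃ᵐ X :=
      { toEquiv := f
        measurable_toFun := hf'.measurable
        measurable_invFun := fun s hs => by
          rw [← Equiv.image_eq_preimage_symm]
          exact (hf'.measurable.measurableEmbedding f.injective).measurableSet_image' hs }
    have he : MeasurePreserving e μ μ := hf'
    exact MeasurePreserving.symm e he

/-- The subgroup `I_mp(X, μ)` of those `f` in `G_mp(X, μ)` with `f x = x` for `μ`-almost
every `x`. -/
def Imp {X : Type*} [MeasurableSpace X] [StandardBorelSpace X] (μ : Measure X) :
    Subgroup (Gmp μ) where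
  carrier := {f | ∀ᵐ x ∂μ, (f : Equiv.Perm X) x = x}
  mul_mem' := by
    intro f g hf hg
    simp only [Set.mem_ofPred_eq] at hf hg ⊢
    filter_upwards [hg, g.2.quasiMeasurePreserving.ae hf] with x h1 h2
    simp [h1] at h2 ⊢
    exact h2
  one_mem' := by simp
  inv_mem' := by
    intro f hf
    simp only [Set.mem_ofPred_eq] at hf ⊢
    filter_upwards [hf] with x hx
    exact Equiv.Perm.inv_eq_iff_eq.mpr hx.symm

instance Imp.normal {X : Type*} [MeasurableSpace X] [StandardBorelSpace X] (μ : Measure X) :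
    (Imp μ).Normal where
  conj_mem := by
    intro f hf g
    have hf' : ∀ᵐ x ∂μ, (f : Equiv.Perm X) x = x := hf
    have hg : MeasurePreserving ((g⁻¹ : Gmp μ) : Equiv.Perm X) μ μ := (g⁻¹).2
    change ∀ᵐ x ∂μ, ((g * f * g⁻¹ : Gmp μ) : Equiv.Perm X) x = x
    filter_upwards [hg.quasiMeasurePreserving.ae hf'] with x hx
    simp at hx ⊢
    simp [hx]

/-- The group `Aut(X, μ) = G_mp(X, μ) / I_mp(X, μ)` of measure preserving transformations. -/
abbrev AutMp {X : Type*} [MeasurableSpace X] [StandardBorelSpace X] (μ : Measure X) : Type _ :=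
  Gmp μ ⧸ Imp μ

/-- The canonical homomorphism of `G_mp(X, μ)` onto `Aut(X, μ)`. -/
abbrev quotientMap {X : Type*} [MeasurableSpace X] [StandardBorelSpace X] (μ : Measure X) :
    Gmp μ →* AutMp μ :=
  QuotientGroup.mk' (Imp μ)

/-! By CH the group has at most `ℵ₁` elements, so a lift can be built by recursion through countable
subgroups, with unions at limits. The point is to extend a lift from a countable `G` to a countable
`K ⊇ G`. Off an invariant null set `Y`, arbitrary representatives of `K` already form an action
extending the lift; on `Y`, measure plays no role, but a Borel action of `G` need not extend to `K`.

It does extend if it contains a copy of the shift of `G`: by an equivariant Cantor-Bernstein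
argument it is then isomorphic to the shift of `K` restricted to `G`. To have such a copy at every
stage, a null set is reserved, fibred over codes `z` of partial actions on `ℕ`. While `z` codes an
action of the current group, the lift permutes coordinates in its fibre as `z` says. Some `z` codes
a regular action of `G` but no action of `K`; its fibre supplies the shift when passing to `K`, and
codes that still act for `K` keep their promise. -/

theorem Subgroup.countable_closure {G : Type*} [Group G] {s : Set G} (hs : s.Countable) :
    (Subgroup.closure s : Set G).Countable := by
  have : Countable s := hs
  have : Countable (FreeGroup s) := Quot.mk_surjective.countable
  rw [FreeGroup.closure_eq_range, MonoidHom.coe_range]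
  exact Set.countable_range _

/-! ### Extending Borel actions of countable groups -/

/-- An equivariant form of the Borel Cantor-Schröder-Bernstein theorem. -/
theorem exists_equivariant_measurableEquiv {ι A B : Type*} [Group ι] [MeasurableSpace A]
    [StandardBorelSpace A] [MeasurableSpace B] [MeasurableSpace.CountablySeparated B]
    {f : A → B} {g : B → A} (hf : MeasurableEmbedding f) (hg : MeasurableEmbedding g)
    {a : ι →* Equiv.Perm A} {b : ι →* Equiv.Perm B} (hfa : ∀ i x, f (a i x) = b i (f x))
    (hgb : ∀ i y, g (b i y) = a i (g y)) :
    ∃ e : A ≃ᵐ B, ∀ i x, e (a i x) = b i (e x) := by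
  classical
  rcases isEmpty_or_nonempty B with hB | hB
  · have : IsEmpty A := ⟨fun x => hB.elim (f x)⟩
    exact ⟨⟨Equiv.equivOfIsEmpty A B, measurable_of_empty _, measurable_of_empty _⟩,
      fun _ x => this.elim x⟩
  -- These are the points whose backward history under `g ∘ f` ends outside the range of `g`.
  -- Equivariance makes that range, hence `S`, invariant; use `f` on `S` and the inverse of `g`
  -- elsewhere.
  let S : Set A := ⋃ n : ℕ, (g ∘ f)^[n] '' (Set.range g)ᶜ
  have hgf : MeasurableEmbedding (g ∘ f) := hg.comp hf
  have hSm : MeasurableSet S := by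
    refine MeasurableSet.iUnion fun n => ?_
    induction n with
    | zero => simpa using hg.measurableSet_range
    | succ n ih =>
      rw [Function.iterate_succ', Set.image_comp]
      exact hgf.measurableSet_image' ih
  have hS0 : ∀ x ∉ S, ∃ y, g y = x := by
    intro x hx
    by_contra h
    exact hx (Set.mem_iUnion.2 ⟨0, x, h, rfl⟩)
  have hS1 : ∀ x, g (f x) ∈ S ↔ x ∈ S := by
    intro x
    constructor
    · intro h
      obtain ⟨n, y, hy, hyx⟩ := Set.mem_iUnion.1 h
      cases n with
      | zero => exact (hy ⟨f x, hyx.symm⟩).elim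
      | succ n =>
        rw [Function.iterate_succ_apply'] at hyx
        exact Set.mem_iUnion.2 ⟨n, y, hy, hgf.injective hyx⟩
    · intro h
      obtain ⟨n, y, hy, hyx⟩ := Set.mem_iUnion.1 h
      refine Set.mem_iUnion.2 ⟨n + 1, y, hy, ?_⟩
      rw [Function.iterate_succ_apply', hyx]
      rfl
  have hrange : ∀ i x, a i x ∈ Set.range g → x ∈ Set.range g := by
    rintro i x ⟨y, hy⟩
    exact ⟨b i⁻¹ y, by rw [hgb, hy]; simp⟩
  have hiter : ∀ i (n : ℕ) x, a i ((g ∘ f)^[n] x) = (g ∘ f)^[n] (a i x) := by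
    intro i n
    induction n with
    | zero => intro x; rfl
    | succ n ih =>
      intro x
      rw [Function.iterate_succ_apply, ih, Function.iterate_succ_apply]
      simp [hfa, hgb]
  have hSa' : ∀ i x, x ∈ S → a i x ∈ S := by
    intro i x h
    obtain ⟨n, y, hy, rfl⟩ := Set.mem_iUnion.1 h
    exact Set.mem_iUnion.2 ⟨n, a i y, fun h => hy (hrange i y h), (hiter i n y).symm⟩
  have hSa : ∀ i x, a i x ∈ S ↔ x ∈ S :=
    fun i x => ⟨fun h => by simpa using hSa' i⁻¹ _ h, hSa' i x⟩
  let E : A → B := fun x => if x ∈ S then f x else hg.invFun x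
  have hEg : ∀ y, g y ∉ S → E (g y) = y := fun y h => by
    simp only [E, h, if_false]
    exact hg.leftInverse_invFun y
  have hEf : ∀ x ∈ S, E x = f x := fun x h => by simp only [E, h, if_true]
  have hEm : Measurable E := Measurable.ite hSm hf.measurable hg.measurable_invFun
  have hEi : Function.Injective E := by
    intro x y hxy
    by_cases hx : x ∈ S <;> by_cases hy : y ∈ S
    · rw [hEf x hx, hEf y hy] at hxy
      exact hf.injective hxy
    · obtain ⟨y, rfl⟩ := hS0 y hy
      rw [hEf x hx, hEg y hy] at hxy
      rw [← hxy, hS1] at hy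
      exact (hy hx).elim
    · obtain ⟨x, rfl⟩ := hS0 x hx
      rw [hEf y hy, hEg x hx] at hxy
      rw [hxy, hS1] at hx
      exact (hx hy).elim
    · obtain ⟨x, rfl⟩ := hS0 x hx
      obtain ⟨y, rfl⟩ := hS0 y hy
      rw [hEg x hx, hEg y hy] at hxy
      rw [hxy]
  have hEs : Function.Surjective E := by
    intro y
    by_cases hy : g y ∈ S
    · obtain ⟨n, x, hx, hxy⟩ := Set.mem_iUnion.1 hy
      cases n with
      | zero => exact (hx ⟨y, hxy.symm⟩).elim
      | succ n =>
        rw [Function.iterate_succ_apply'] at hxy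
        have hm : (g ∘ f)^[n] x ∈ S := Set.mem_iUnion.2 ⟨n, x, hx, rfl⟩
        exact ⟨_, (hEf _ hm).trans (hg.injective hxy)⟩
    · exact ⟨g y, hEg y hy⟩
  have hEE := hEm.measurableEmbedding hEi
  let e := Equiv.ofBijective E ⟨hEi, hEs⟩
  refine ⟨⟨e, hEm, ?_⟩, ?_⟩
  · intro s hs
    rw [← Equiv.image_eq_preimage_symm]
    exact hEE.measurableSet_image' hs
  · intro i x
    change E (a i x) = b i (E x)
    by_cases hx : x ∈ S
    · rw [hEf x hx, hEf _ ((hSa i x).2 hx), hfa]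
    · have hx' := mt (hSa i x).1 hx
      obtain ⟨y, rfl⟩ := hS0 x hx
      rw [hEg y hx]
      rw [← hgb] at hx' ⊢
      exact hEg _ hx'

/-- Every Borel action of a countable group embeds into the shift action on `K → (ℕ → Bool)`
restricted along an injective homomorphism. -/
theorem exists_embedding_shift {G K W : Type*} [Group G] [Group K] [Countable K]
    [MeasurableSpace W] [StandardBorelSpace W] (j : G →* K) (hj : Function.Injective j)
    (a : G →* Equiv.Perm W) (ha : ∀ g, Measurable (a g)) :
    ∃ F : W → K → ℕ → Bool, MeasurableEmbedding F ∧
      ∀ g w x, F (a g w) x = F w ((j g)⁻¹ * x) := by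
  classical
  let φ := MeasurableSpace.mapNatBool W
  -- The value at `j 1` recovers `w`. The constant default is harmless because left translation by
  -- `j g` preserves the complement of the range of `j`.
  let F : W → K → ℕ → Bool := fun w x =>
    if h : ∃ g, j g = x then φ (a h.choose⁻¹ w) else fun _ => false
  have hF : ∀ w g, F w (j g) = φ (a g⁻¹ w) := by
    intro w g
    have h : ∃ g', j g' = j g := ⟨g, rfl⟩
    have := hj h.choose_spec
    simp only [F, dif_pos h, this]
  have hF' : ∀ w x, (¬ ∃ g, j g = x) → F w x = fun _ => false := by
    intro w x h
    simp only [F, dif_neg h]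
  refine ⟨F, Measurable.measurableEmbedding ?_ ?_, ?_⟩
  · refine measurable_pi_iff.2 fun x => ?_
    by_cases h : ∃ g, j g = x
    · obtain ⟨g, rfl⟩ := h
      simp only [hF]
      exact (MeasurableSpace.measurable_mapNatBool W).comp (ha _)
    · simp only [hF' _ x h]
      exact measurable_const
  · intro v w h
    have := congrFun h (j 1)
    rw [hF, hF] at this
    simpa using MeasurableSpace.injective_mapNatBool W this
  · intro g w x
    by_cases h : ∃ g, j g = x
    · obtain ⟨k, rfl⟩ := h
      rw [← map_inv, ← map_mul, hF, hF]
      simp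
    · rw [hF' _ _ h, hF']
      rintro ⟨k, hk⟩
      exact h ⟨g * k, by rw [map_mul, hk]; simp⟩

/-- The shift action of a group on functions. -/
def shiftAction (K C : Type*) [Group K] : K →* Equiv.Perm (K → C) :=
  MonoidHom.toHomPerm
    { toFun := fun k t x => t (k⁻¹ * x)
      map_one' := funext fun t => funext fun x => by
        change t (1⁻¹ * x) = t x
        simp
      map_mul' := fun k l => funext fun t => funext fun x => by
        change t ((k * l)⁻¹ * x) = t (l⁻¹ * (k⁻¹ * x))
        rw [mul_inv_rev, mul_assoc] }

theorem measurable_shiftAction {K C : Type*} [Group K] [MeasurableSpace C] (k : K) :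
    Measurable (shiftAction K C k) :=
  measurable_pi_iff.2 fun x => measurable_pi_apply (k⁻¹ * x)

/-- A Borel action of a countable group that contains a copy of the shift extends to a Borel
action of any countable overgroup. -/
theorem exists_extend_action {G K Y : Type*} [Group G] [Group K] [Countable K]
    [MeasurableSpace Y] [StandardBorelSpace Y] (j : G →* K) (hj : Function.Injective j)
    (a : G →* Equiv.Perm Y) (ha : ∀ g, Measurable (a g))
    {u : (G → ℕ → Bool) → Y} (hu : MeasurableEmbedding u)
    (hua : ∀ g t, u (shiftAction G (ℕ → Bool) g t) = a g (u t)) :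
    ∃ b : K →* Equiv.Perm Y, (∀ k, Measurable (b k)) ∧ ∀ g, b (j g) = a g := by
  have : Countable G := hj.countable
  obtain ⟨F, hF, hFa⟩ := exists_embedding_shift j hj a ha
  let s := shiftAction K (ℕ → Bool)
  -- The shift of `K`, seen as a `G`-action, embeds into the shift of `G` and so, through `u`, into
  -- `Y`.
  obtain ⟨F', hF', hFs⟩ := exists_embedding_shift (MonoidHom.id G) Function.injective_id
    (s.comp j) (fun g => measurable_shiftAction (j g))
  obtain ⟨e, he⟩ := exists_equivariant_measurableEquiv hF (hu.comp hF') (a := a) (b := s.comp j)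
    (fun g y => by
      ext1 x
      exact hFa g y x)
    (fun g t => by
      rw [Function.comp_apply, Function.comp_apply, ← hua]
      congr 1
      ext1 x
      exact hFs g t x)
  refine ⟨e.toEquiv.symm.permCongrHom.toMonoidHom.comp s, fun k => ?_, fun g => ?_⟩
  · exact e.symm.measurable.comp ((measurable_shiftAction k).comp e.measurable)
  · ext y
    exact (e.symm_apply_eq).2 (he g y).symm

/-- A version of `exists_extend_action` for an action on a Borel subset, given by functions on
the ambient space. -/
theorem exists_extend_action_on {G K X : Type*} [Group G] [Group K] [Countable K]
    [MeasurableSpace X] [StandardBorelSpace X] (j : G →* K) (hj : Function.Injective j)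
    {Y : Set X} (hY : MeasurableSet Y) {a : G → X → X} (ha : ∀ g, Measurable (a g))
    (haY : ∀ g, ∀ x ∈ Y, a g x ∈ Y) (ha1 : ∀ x ∈ Y, a 1 x = x)
    (hamul : ∀ g h, ∀ x ∈ Y, a (g * h) x = a g (a h x))
    {u : (G → ℕ → Bool) → X} (hu : Measurable u) (hui : Function.Injective u)
    (huY : ∀ t, u t ∈ Y) (hua : ∀ g t, u (shiftAction G (ℕ → Bool) g t) = a g (u t)) :
    ∃ b : K → X → X, (∀ k, Measurable (b k)) ∧ (∀ k, ∀ x ∈ Y, b k x ∈ Y) ∧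
      (∀ x ∈ Y, b 1 x = x) ∧ (∀ k l, ∀ x ∈ Y, b (k * l) x = b k (b l x)) ∧
      ∀ g, ∀ x ∈ Y, b (j g) x = a g x := by
  classical
  have : StandardBorelSpace Y := hY.standardBorel
  have : Countable G := hj.countable
  let a' : G →* Equiv.Perm Y := MonoidHom.toHomPerm
    { toFun := fun g y => ⟨a g y, haY g y y.2⟩
      map_one' := funext fun y => Subtype.ext (ha1 y y.2)
      map_mul' := fun g h => funext fun y => Subtype.ext (hamul g h y y.2) }
  obtain ⟨b, hb, hba⟩ := exists_extend_action j hj a'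
    (fun g => ((ha g).comp measurable_subtype_coe).subtype_mk)
    (u := fun t => (⟨u t, huY t⟩ : Y))
    (hu.subtype_mk.measurableEmbedding fun s t h => hui (congrArg Subtype.val h))
    (fun g t => Subtype.ext (hua g t))
  have hbY : ∀ k (x : X) (hx : x ∈ Y),
      (if h : x ∈ Y then (b k ⟨x, h⟩ : X) else x) = b k ⟨x, hx⟩ := fun k x hx => dif_pos hx
  refine ⟨fun k x => if h : x ∈ Y then b k ⟨x, h⟩ else x, fun k => ?_, ?_, ?_, ?_, ?_⟩
  · exact Measurable.dite (f := fun y : Y => (b k y : X)) (measurable_subtype_coe.comp (hb k))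
      (g := fun y : (Yᶜ : Set X) => (y : X)) measurable_subtype_coe hY
  · intro k x hx
    simp only [hbY _ _ hx]
    exact (b k ⟨x, hx⟩).2
  · intro x hx
    simp [hx]
  · intro k l x hx
    simp [hx]
  · intro g x hx
    refine (hbY _ _ hx).trans ?_
    rw [hba]
    rfl

/-! ### Recursion of length at most `ω₁` -/

/-- Along a well-order with countable initial segments, one can build a chain that meets every
requirement, provided that countable chains are bounded and every element can be extended. -/
theorem exists_chain_of_card_le_aleph_one {A P : Type*} [Preorder P]
    (hA : Cardinal.mk A ≤ Cardinal.aleph 1) (D : P → Set A)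
    (hchain : ∀ S : Set P, S.Countable → IsChain (· ≤ ·) S → BddAbove S)
    (hext : ∀ p a, ∃ q, p ≤ q ∧ a ∈ D q) :
    ∃ F : A → P, (∀ a b, F a ≤ F b ∨ F b ≤ F a) ∧ ∀ a, a ∈ D (F a) := by
  classical
  obtain ⟨r, wo, hr⟩ := Cardinal.exists_ord_eq A
  have hseg : ∀ a, {b | r b a}.Countable := by
    intro a
    have h := (Cardinal.card_typein_lt a hr).trans_le hA
    rw [← Cardinal.succ_aleph0, Order.lt_succ_iff] at h
    exact Cardinal.le_aleph0_iff_set_countable.1 h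
  -- The step is total, so the recursion can be defined before its earlier values are known to form
  -- a chain.
  have hstep : ∀ (S : Set P) (a : A), ∃ q, (S.Countable → IsChain (· ≤ ·) S → ∀ p ∈ S, p ≤ q) ∧
      a ∈ D q := by
    intro S a
    obtain ⟨p₀, -⟩ := hchain ∅ Set.countable_empty (by simp)
    by_cases h : S.Countable ∧ IsChain (· ≤ ·) S
    · obtain ⟨p, hp⟩ := hchain S h.1 h.2
      obtain ⟨q, hq, ha⟩ := hext p a
      exact ⟨q, fun _ _ s hs => (hp hs).trans hq, ha⟩
    · obtain ⟨q, hq, ha⟩ := hext p₀ a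
      exact ⟨q, fun h1 h2 => (h ⟨h1, h2⟩).elim, ha⟩
  choose step hle hmem using hstep
  let F : A → P := wo.wf.fix fun a ih => step {p | ∃ b, ∃ h : r b a, ih b h = p} a
  have hF : ∀ a, F a = step (F '' {b | r b a}) a := by
    intro a
    refine (wo.wf.fix_eq _ a).trans ?_
    congr 1
    ext p
    simp [F]
  have hmono : ∀ a b, r b a → F b ≤ F a := by
    intro a
    induction a using wo.wf.induction with
    | _ a ih =>
      intro b hb
      rw [hF a]
      refine hle _ a ((hseg a).image F) ?_ _ ⟨b, hb, rfl⟩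
      rintro _ ⟨c, hc, rfl⟩ _ ⟨d, hd, rfl⟩ -
      rcases trichotomous_of r c d with h | h | h
      · exact Or.inl (ih d hd c h)
      · exact Or.inl (h ▸ le_rfl)
      · exact Or.inr (ih c hc d h)
  refine ⟨F, fun a b => ?_, fun a => ?_⟩
  · rcases trichotomous_of r a b with h | h | h
    · exact Or.inl (hmono b a h)
    · exact Or.inl (h ▸ le_rfl)
    · exact Or.inr (hmono a b h)
  · rw [hF]
    exact hmem _ a

/-- A Borel map is determined by the preimages of a countable separating family, and there are at
most continuum many Borel sets. -/
theorem mk_AutMp_le_continuum {X : Type*} [MeasurableSpace X] [StandardBorelSpace X]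
    (μ : Measure X) : Cardinal.mk (AutMp μ) ≤ Cardinal.continuum := by
  refine (Cardinal.mk_le_of_surjective (QuotientGroup.mk'_surjective (Imp μ))).trans ?_
  let M := {s : Set X // MeasurableSet s}
  have hM : Cardinal.mk M ≤ Cardinal.continuum := by
    have hg := MeasurableSpace.generateFrom_countableGeneratingSet (α := X)
    have := MeasurableSpace.cardinal_measurableSet_le_continuum
      (s := MeasurableSpace.countableGeneratingSet X)
      ((Cardinal.le_aleph0_iff_set_countable.2
        (MeasurableSpace.countable_countableGeneratingSet (α := X))).trans
        Cardinal.aleph0_le_continuum)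
    rw [hg] at this
    exact this
  let φ := MeasurableSpace.mapNatBool X
  have hφ : ∀ n, Measurable fun x => φ x n :=
    fun n => (measurable_pi_apply n).comp (MeasurableSpace.measurable_mapNatBool X)
  let J : Gmp μ → ℕ → M := fun f n =>
    ⟨{x | φ ((f : Equiv.Perm X) x) n = true},
      ((hφ n).comp f.2.measurable) (measurableSet_singleton true)⟩
  have hJ : Function.Injective J := by
    intro f g h
    refine Subtype.ext (Equiv.ext fun x => MeasurableSpace.injective_mapNatBool X ?_)
    ext1 n
    have h1 : ({x | φ ((f : Equiv.Perm X) x) n = true} : Set X) =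
        {x | φ ((g : Equiv.Perm X) x) n = true} := congrArg Subtype.val (congrFun h n)
    have h2 : φ ((f : Equiv.Perm X) x) n = true ↔ φ ((g : Equiv.Perm X) x) n = true :=
      Set.ext_iff.1 h1 x
    exact Bool.eq_iff_iff.2 h2
  refine (Cardinal.mk_le_of_injective hJ).trans ?_
  rw [Cardinal.mk_pi, Cardinal.prod_const, Cardinal.lift_uzero, Cardinal.mk_nat,
    Cardinal.lift_aleph0]
  exact (Cardinal.power_le_power_right hM).trans Cardinal.continuum_power_aleph0.le

/-! ### Codes for actions on `ℕ` and the reserved null set -/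

/-- Codes for countable partial functions from a set of size continuum to `ℕ → ℕ`. -/
abbrev FunCode : Type := ℕ → (ℕ → Bool) × (ℕ → ℕ)

/-- There is a Borel parametrization of functions `A → (ℕ → ℕ)` in which every prescription on a
nonempty countable set occurs, with value `0` elsewhere. -/
theorem exists_parametrization {A : Type*} (hA : Cardinal.mk A ≤ Cardinal.continuum) :
    ∃ f : FunCode → A → ℕ → ℕ, (∀ a n, Measurable fun z => f z a n) ∧
      ∀ (S : Set A) (φ : A → ℕ → ℕ), S.Countable → S.Nonempty →
        ∃ z, (∀ a ∈ S, f z a = φ a) ∧ ∀ a ∉ S, f z a = fun _ => 0 := by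
  classical
  have hc : ∃ c : A → ℕ → Bool, Function.Injective c := by
    have h : Nonempty (A ↪ (ℕ → Bool)) := by
      rw [← Cardinal.lift_mk_le']
      simpa using hA
    exact ⟨h.some, h.some.injective⟩
  obtain ⟨c, hc⟩ := hc
  -- The second alternative makes the search for the first index succeed even when `c a` does not
  -- occur; the value is then `0`.
  have hex : ∀ (a : A) (z : FunCode), ∃ i, (z i).1 = c a ∨ ∀ j, (z j).1 ≠ c a := by
    intro a z
    by_cases h : ∃ i, (z i).1 = c a
    · exact ⟨h.choose, Or.inl h.choose_spec⟩
    · exact ⟨0, Or.inr fun j hj => h ⟨j, hj⟩⟩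
  let f : FunCode → A → ℕ → ℕ := fun z a n =>
    (fun i (z : FunCode) => if (z i).1 = c a then (z i).2 n else 0) (Nat.find (hex a z)) z
  have hset : ∀ a i, MeasurableSet {z : FunCode | (z i).1 = c a} := fun a i =>
    measurableSet_eq_fun (measurable_fst.comp (measurable_pi_apply i)) measurable_const
  refine ⟨f, fun a n => ?_, fun S φ hS hne => ?_⟩
  · refine Measurable.find (f := fun i (z : FunCode) => if (z i).1 = c a then (z i).2 n else 0)
      (fun i => ?_) (fun i => ?_) (hex a)
    · exact Measurable.ite (hset a i)
        ((measurable_pi_apply n).comp (measurable_snd.comp (measurable_pi_apply i)))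
        measurable_const
    · refine (hset a i).union ?_
      have : {z : FunCode | ∀ j, (z j).1 ≠ c a} = ⋂ j, {z : FunCode | (z j).1 = c a}ᶜ := by
        ext z
        simp
      change MeasurableSet {z : FunCode | ∀ j, (z j).1 ≠ c a}
      rw [this]
      exact MeasurableSet.iInter fun j => (hset a j).compl
  · obtain ⟨e, rfl⟩ := hS.exists_eq_range hne
    refine ⟨fun i => (c (e i), φ (e i)), ?_, ?_⟩
    · rintro _ ⟨k, rfl⟩
      ext n
      rcases Nat.find_spec (hex (e k) fun i => (c (e i), φ (e i))) with h | h
      · simp only [f]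
        rw [if_pos h]
        simp only at h ⊢
        rw [hc h]
      · exact (h k rfl).elim
    · intro a ha
      ext n
      simp only [f]
      rw [if_neg]
      intro h
      exact ha ⟨_, hc h⟩

/-- A standard Borel space with a non-atomic probability measure contains a null copy of every
standard Borel space. -/
theorem exists_measurableEmbedding_null {X Z : Type*} [MeasurableSpace X] [StandardBorelSpace X]
    (μ : Measure X) [IsProbabilityMeasure μ] [NullSingletonClass μ] [MeasurableSpace Z]
    [StandardBorelSpace Z] [Nonempty Z] :
    ∃ f : Z → X, MeasurableEmbedding f ∧ μ (Set.range f) = 0 := by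
  have hX : ¬ Countable X := by
    intro h
    have : μ Set.univ = 0 := Set.Countable.measure_zero Set.countable_univ μ
    simp at this
  have hC : ¬ Countable (ℕ → Bool) := by
    rw [← Cardinal.mk_le_aleph0_iff]
    simp [Cardinal.aleph0_lt_continuum]
  have hZ : ¬ Countable (Z × (ℕ → Bool)) := fun h =>
    hC (Function.Surjective.countable (f := (Prod.snd : Z × (ℕ → Bool) → ℕ → Bool))
      Prod.snd_surjective)
  -- This splits `X` into uncountably many disjoint copies of `Z`, only countably many of which can
  -- have positive measure.
  let e := PolishSpace.measurableEquivOfNotCountable hZ hX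
  let f : (ℕ → Bool) → Z → X := fun c z => e (z, c)
  have hf : ∀ c, MeasurableEmbedding (f c) := fun c =>
    Measurable.measurableEmbedding (e.measurable.comp (measurable_id.prodMk measurable_const))
      fun x y h => (Prod.ext_iff.1 (e.injective h)).1
  have hcount := Measure.countable_meas_pos_of_disjoint_iUnion (μ := μ)
    (As := fun c => Set.range (f c)) (fun c => (hf c).measurableSet_range) (by
      intro c d hcd
      rw [Function.onFun, Set.disjoint_left]
      rintro _ ⟨z, rfl⟩ ⟨w, hw⟩
      exact hcd (Prod.ext_iff.1 (e.injective hw)).2.symm)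
  by_contra! h
  refine hC ?_
  rw [← Set.countable_univ_iff]
  refine hcount.mono fun c _ => ?_
  exact pos_iff_ne_zero.2 (h (f c) (hf c))

/-- `φ` restricts to an action of the subgroup `G` on `ℕ`. -/
def IsActionOn {A : Type*} [Group A] (φ : A → ℕ → ℕ) (G : Subgroup A) : Prop :=
  φ 1 = id ∧ ∀ g ∈ G, ∀ h ∈ G, φ (g * h) = φ g ∘ φ h

theorem IsActionOn.mono {A : Type*} [Group A] {φ : A → ℕ → ℕ} {G H : Subgroup A}
    (h : IsActionOn φ H) (hGH : G ≤ H) : IsActionOn φ G :=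
  ⟨h.1, fun g hg k hk => h.2 g (hGH hg) k (hGH hk)⟩

theorem measurable_apply_nat {Z C : Type*} [MeasurableSpace Z] [MeasurableSpace C]
    {F : Z → ℕ → C} (hF : ∀ n, Measurable fun z => F z n) {m : Z → ℕ} (hm : Measurable m) :
    Measurable fun z => F z (m z) := by
  have h : Measurable fun p : Z × ℕ => F p.1 p.2 := measurable_from_prod_countable_left hF
  exact h.comp (measurable_id.prodMk hm)

theorem measurableSet_isActionOn {A Z : Type*} [Group A] [MeasurableSpace Z]
    {f : Z → A → ℕ → ℕ} (hf : ∀ a n, Measurable fun z => f z a n) {G : Subgroup A}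
    (hG : (G : Set A).Countable) : MeasurableSet {z | IsActionOn (f z) G} := by
  have h : {z | IsActionOn (f z) G} = (⋂ n, {z | f z 1 n = n}) ∩
      ⋂ g ∈ (G : Set A), ⋂ h ∈ (G : Set A), ⋂ n, {z | f z (g * h) n = f z g (f z h n)} := by
    ext z
    simp [IsActionOn, funext_iff]
  rw [h]
  refine (MeasurableSet.iInter fun n => measurableSet_eq_fun (hf 1 n) measurable_const).inter ?_
  exact MeasurableSet.biInter hG fun g _ => MeasurableSet.biInter hG fun h _ =>
    MeasurableSet.iInter fun n =>
      measurableSet_eq_fun (hf _ n) (measurable_apply_nat (hf g) (hf h n))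

/-- The candidate action of `g` on pairs of a parameter `z` and a point of `(ℕ → Bool) ^ ℕ`,
permuting coordinates as prescribed by `z`. -/
def prescribed {A Z C : Type*} [Group A] (f : Z → A → ℕ → ℕ) (g : A) (p : Z × (ℕ → C)) :
    Z × (ℕ → C) := (p.1, p.2 ∘ f p.1 g⁻¹)

theorem measurable_prescribed {A Z C : Type*} [Group A] [MeasurableSpace Z] [MeasurableSpace C]
    {f : Z → A → ℕ → ℕ} (hf : ∀ a n, Measurable fun z => f z a n) (g : A) :
    Measurable (prescribed (C := C) f g) := by
  refine measurable_fst.prodMk (measurable_pi_iff.2 fun n => ?_)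
  exact measurable_apply_nat (F := fun p : Z × (ℕ → C) => p.2)
    (fun n => (measurable_pi_apply n).comp measurable_snd) ((hf g⁻¹ n).comp measurable_fst)

theorem prescribed_one {A Z C : Type*} [Group A] {f : Z → A → ℕ → ℕ} {G : Subgroup A}
    {p : Z × (ℕ → C)} (hp : IsActionOn (f p.1) G) : prescribed f 1 p = p := by
  simp [prescribed, hp.1]

theorem prescribed_mul {A Z C : Type*} [Group A] {f : Z → A → ℕ → ℕ} {G : Subgroup A}
    {p : Z × (ℕ → C)} (hp : IsActionOn (f p.1) G) {g h : A} (hg : g ∈ G) (hh : h ∈ G) :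
    prescribed f (g * h) p = prescribed f g (prescribed f h p) := by
  simp only [prescribed, mul_inv_rev]
  rw [hp.2 _ (inv_mem hh) _ (inv_mem hg)]
  rfl

/-! ### Actions modulo null sets -/

section

variable {X : Type*} [MeasurableSpace X] [StandardBorelSpace X] {μ : Measure X}

/-- Add to `B` all points moved by elements of `S` that are trivial almost everywhere, then saturate
under `S`; countability keeps the result null. -/
theorem exists_null_invariant {S : Subgroup (Gmp μ)} (hS : (S : Set (Gmp μ)).Countable)
    {B : Set X} (hB : MeasurableSet B) (hB0 : μ B = 0) :
    ∃ Y, MeasurableSet Y ∧ μ Y = 0 ∧ B ⊆ Y ∧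
      (∀ k ∈ S, ∀ x, (k : Equiv.Perm X) x ∈ Y ↔ x ∈ Y) ∧
      ∀ k ∈ S, ∀ l ∈ S, quotientMap μ k = quotientMap μ l → ∀ x ∉ Y,
        (k : Equiv.Perm X) x = (l : Equiv.Perm X) x := by
  let B' : Set X := B ∪ ⋃ k ∈ (S : Set (Gmp μ)) ∩ Imp μ, {x | (k : Equiv.Perm X) x = x}ᶜ
  have hSI : ((S : Set (Gmp μ)) ∩ Imp μ).Countable := hS.mono Set.inter_subset_left
  have hB' : MeasurableSet B' := hB.union <| MeasurableSet.biUnion hSI fun k _ =>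
    (measurableSet_eq_fun k.2.measurable measurable_id).compl
  have hB'0 : μ B' = 0 := measure_union_null hB0 <|
    (measure_biUnion_null_iff hSI).2 fun k hk => hk.2
  let Y : Set X := ⋃ k ∈ (S : Set (Gmp μ)), (k : Equiv.Perm X) ⁻¹' B'
  have hYmem : ∀ x, x ∈ Y ↔ ∃ k ∈ S, (k : Equiv.Perm X) x ∈ B' := by
    intro x
    simp [Y]
  have hBY : B' ⊆ Y := fun x hx => (hYmem x).2 ⟨1, one_mem S, hx⟩
  have hinv : ∀ k ∈ S, ∀ x, x ∈ Y → (k : Equiv.Perm X) x ∈ Y := by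
    intro k hk x hx
    obtain ⟨l, hl, hlx⟩ := (hYmem x).1 hx
    exact (hYmem _).2 ⟨l * k⁻¹, mul_mem hl (inv_mem hk), by simpa using hlx⟩
  refine ⟨Y, ?_, ?_, Set.subset_union_left.trans hBY, ?_, ?_⟩
  · exact MeasurableSet.biUnion hS fun k _ => k.2.measurable hB'
  · refine (measure_biUnion_null_iff hS).2 fun k _ => ?_
    rw [k.2.measure_preimage hB'.nullMeasurableSet, hB'0]
  · exact fun k hk x => ⟨fun h => by simpa using hinv k⁻¹ (inv_mem hk) _ h, hinv k hk x⟩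
  · intro k hk l hl hkl x hx
    by_contra hne
    have hmem : k⁻¹ * l ∈ (S : Set (Gmp μ)) ∩ Imp μ :=
      ⟨mul_mem (inv_mem hk) hl, QuotientGroup.eq.1 hkl⟩
    refine hx (hBY (Or.inr (Set.mem_iUnion₂.2 ⟨_, hmem, fun h => hne ?_⟩)))
    have h' : (k : Equiv.Perm X)⁻¹ ((l : Equiv.Perm X) x) = x := h
    rw [Equiv.Perm.inv_eq_iff_eq] at h'
    exact h'.symm

/-- A Borel action that almost everywhere agrees with representatives consists of lifts. -/
theorem exists_lift_of_action {K : Subgroup (AutMp μ)} {b : K → X → X}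
    (hb : ∀ k, Measurable (b k)) (hb1 : ∀ x, b 1 x = x)
    (hbmul : ∀ k l x, b (k * l) x = b k (b l x))
    (hae : ∀ k : K, ∃ r : Gmp μ, quotientMap μ r = k ∧ ∀ᵐ x ∂μ, b k x = (r : Equiv.Perm X) x) :
    ∃ lift : AutMp μ → Gmp μ, (∀ k : K, ∀ x, (lift k : Equiv.Perm X) x = b k x) ∧
      ∀ k : K, quotientMap μ (lift k) = k := by
  classical
  have hmk : ∀ k : K, ∃ f : Gmp μ, ∀ x, (f : Equiv.Perm X) x = b k x := by
    intro k
    obtain ⟨r, -, hr⟩ := hae k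
    refine ⟨⟨⟨b k, b k⁻¹, fun x => ?_, fun x => ?_⟩, ?_⟩, fun x => rfl⟩
    · rw [← hbmul, inv_mul_cancel, hb1]
    · rw [← hbmul, mul_inv_cancel, hb1]
    · exact ⟨hb k, (Measure.map_congr hr).trans r.2.map_eq⟩
  choose f hf using hmk
  refine ⟨fun a => if h : a ∈ K then f ⟨a, h⟩ else 1, fun k x => ?_, fun k => ?_⟩
  · beta_reduce
    rw [dif_pos k.2]
    exact hf k x
  · beta_reduce
    rw [dif_pos k.2]
    obtain ⟨r, hrk, hr⟩ := hae k
    refine Eq.trans ?_ hrk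
    refine QuotientGroup.eq.2 ?_
    change ∀ᵐ x ∂μ, (f k : Equiv.Perm X)⁻¹ ((r : Equiv.Perm X) x) = x
    filter_upwards [hr] with x hx
    rw [Equiv.Perm.inv_eq_iff_eq, hf, hx]

end

/-! ### Partial lifts and their unions -/

/-- A lift of a countable subgroup of `Aut(X, μ)` which acts as prescribed on the reserved set
`range i`. -/
structure PartialLift {X : Type*} [MeasurableSpace X] [StandardBorelSpace X] (μ : Measure X)
    (f : FunCode → AutMp μ → ℕ → ℕ) (i : FunCode × (ℕ → ℕ → Bool) → X) where
  dom : Subgroup (AutMp μ)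
  countable_dom : (dom : Set (AutMp μ)).Countable
  lift : AutMp μ → Gmp μ
  lift_mul : ∀ g ∈ dom, ∀ h ∈ dom, lift (g * h) = lift g * lift h
  quotientMap_lift : ∀ g ∈ dom, quotientMap μ (lift g) = g
  -- As `dom` grows, fewer codes remain actions. A code that fails releases its fibre, and unions of
  -- chains preserve the condition.
  lift_reserve : ∀ g ∈ dom, ∀ p : FunCode × (ℕ → ℕ → Bool), IsActionOn (f p.1) dom →
    (lift g : Equiv.Perm X) (i p) = i (prescribed f g p)

namespace PartialLift

variable {X : Type*} [MeasurableSpace X] [StandardBorelSpace X] {μ : Measure X}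
  {f : FunCode → AutMp μ → ℕ → ℕ} {i : FunCode × (ℕ → ℕ → Bool) → X}

instance : Preorder (PartialLift μ f i) where
  le p q := p.dom ≤ q.dom ∧ ∀ g ∈ p.dom, q.lift g = p.lift g
  le_refl p := ⟨le_rfl, fun _ _ => rfl⟩
  le_trans p q r h1 h2 :=
    ⟨h1.1.trans h2.1, fun g hg => (h2.2 g (h1.1 hg)).trans (h1.2 g hg)⟩

theorem lift_one (p : PartialLift μ f i) : p.lift 1 = 1 := by
  have h := p.lift_mul 1 (one_mem _) 1 (one_mem _)
  rw [mul_one] at h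
  exact left_eq_mul.1 h

/-- The trivial partial lift. -/
def bot : PartialLift μ f i where
  dom := ⊥
  countable_dom := by simp
  lift := fun _ => 1
  lift_mul := by simp
  quotientMap_lift := by
    intro g hg
    rw [Subgroup.mem_bot.1 hg, map_one]
  lift_reserve := by
    intro g hg p hp
    rw [Subgroup.mem_bot.1 hg, prescribed_one hp]
    rfl

theorem bddAbove_of_isChain {S : Set (PartialLift μ f i)} (hS : S.Countable)
    (hchain : IsChain (· ≤ ·) S) : BddAbove S := by
  classical
  rcases S.eq_empty_or_nonempty with rfl | hne
  · exact ⟨bot, by simp [upperBounds]⟩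
  have : Nonempty S := hne.to_subtype
  have : Countable S := hS
  have hdir : Directed (· ≤ ·) fun p : S => p.1.dom := by
    intro p q
    rcases hchain.total p.2 q.2 with h | h
    · exact ⟨q, h.1, le_rfl⟩
    · exact ⟨p, le_rfl, h.1⟩
  let dom : Subgroup (AutMp μ) := ⨆ p : S, p.1.dom
  have hmem : ∀ {g}, g ∈ dom ↔ ∃ p : S, g ∈ p.1.dom := Subgroup.mem_iSup_of_directed hdir
  let lift : AutMp μ → Gmp μ := fun g => if h : ∃ p : S, g ∈ p.1.dom then h.choose.1.lift g else 1
  have hlift : ∀ p ∈ S, ∀ g ∈ p.dom, lift g = p.lift g := by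
    intro p hp g hg
    have h : ∃ p : S, g ∈ p.1.dom := ⟨⟨p, hp⟩, hg⟩
    simp only [lift, dif_pos h]
    rcases hchain.total h.choose.2 hp with h' | h'
    · exact (h'.2 g h.choose_spec).symm
    · exact h'.2 g hg
  have hle : ∀ p ∈ S, p.dom ≤ dom := fun p hp => le_iSup (fun p : S => p.1.dom) ⟨p, hp⟩
  refine ⟨⟨dom, ?_, lift, ?_, ?_, ?_⟩, fun p hp => ⟨hle p hp, hlift p hp⟩⟩
  · refine (Set.countable_iUnion fun p : S => p.1.countable_dom).mono fun g hg => ?_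
    exact Set.mem_iUnion.2 (hmem.1 hg)
  · intro g hg h hh
    obtain ⟨p, hp⟩ := hmem.1 hg
    obtain ⟨q, hq⟩ := hmem.1 hh
    obtain ⟨r, hpr, hqr⟩ := hdir p q
    rw [hlift r r.2 _ (mul_mem (hpr hp) (hqr hq)), hlift r r.2 _ (hpr hp),
      hlift r r.2 _ (hqr hq), r.1.lift_mul _ (hpr hp) _ (hqr hq)]
  · intro g hg
    obtain ⟨p, hp⟩ := hmem.1 hg
    rw [hlift p p.2 g hp, p.1.quotientMap_lift g hp]
  · intro g hg x hx
    obtain ⟨p, hp⟩ := hmem.1 hg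
    rw [hlift p p.2 g hp, p.1.lift_reserve g hp x (hx.mono (hle p p.2))]

end PartialLift

/-! ### One-step extension -/

namespace PartialLift

variable {X : Type*} [MeasurableSpace X] [StandardBorelSpace X] {μ : Measure X}
  {f : FunCode → AutMp μ → ℕ → ℕ} {i : FunCode × (ℕ → ℕ → Bool) → X}

/-- Some parameter codes the regular action of a countable group, and acts as prescribed on no
larger group; its fibre contains a copy of the shift. -/
theorem exists_shift_copy {G K : Subgroup (AutMp μ)} (hG : (G : Set (AutMp μ)).Countable)
    (hf : ∀ (S : Set (AutMp μ)) (φ : AutMp μ → ℕ → ℕ), S.Countable → S.Nonempty →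
      ∃ z, (∀ a ∈ S, f z a = φ a) ∧ ∀ a ∉ S, f z a = fun _ => 0)
    (hK : ¬ K ≤ G) :
    ∃ z, IsActionOn (f z) G ∧ ¬ IsActionOn (f z) K ∧
      ∃ d : (G → ℕ → Bool) → ℕ → ℕ → Bool, Measurable d ∧ Function.Injective d ∧
        ∀ (g : G) t, d (shiftAction G (ℕ → Bool) g t) = d t ∘ f z (g : AutMp μ)⁻¹ := by
  classical
  have : Countable G := hG
  obtain ⟨e⟩ : Nonempty (ℕ ≃ G × ℕ) := nonempty_equiv_of_countable
  -- Left translation on `G × ℕ`; the second factor makes the set infinite even for finite `G`.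
  let ρ : G → ℕ → ℕ := fun g n => e.symm (g * (e n).1, (e n).2)
  obtain ⟨z, hz, hz'⟩ := hf G (fun a => if h : a ∈ G then ρ ⟨a, h⟩ else id) hG ⟨1, one_mem G⟩
  have hzρ : ∀ g : G, f z g = ρ g := fun g => by rw [hz g g.2, dif_pos g.2]
  refine ⟨z, ⟨?_, ?_⟩, ?_, fun t n => t (e n).1, ?_, ?_, ?_⟩
  · refine (hzρ 1).trans ?_
    ext n
    simp [ρ]
  · intro g hg h hh
    refine (hzρ (⟨g, hg⟩ * ⟨h, hh⟩)).trans ?_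
    rw [hzρ ⟨g, hg⟩, hzρ ⟨h, hh⟩]
    ext n
    simp only [ρ, Function.comp_apply, Equiv.apply_symm_apply, ← mul_assoc]
  -- For `a` in `K` but not in `G`, `f z a` is constantly `0`, so composing with it cannot give the
  -- identity.
  · intro hact
    obtain ⟨a, ha, haG⟩ := SetLike.not_le_iff_exists.1 hK
    have h := hact.2 _ (inv_mem ha) _ ha
    rw [inv_mul_cancel, hact.1, hz' a haG] at h
    have h0 := congrFun h 0
    have h1 := congrFun h 1
    simp only [id, Function.comp_apply] at h0 h1
    omega
  · exact measurable_pi_iff.2 fun n => measurable_pi_apply _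
  · intro s t hst
    ext1 g
    have := congrFun hst (e.symm (g, 0))
    simpa using this
  · intro g t
    ext1 n
    change t (g⁻¹ * (e n).1) = t (e (f z (g⁻¹ : G) n)).1
    rw [hzρ]
    simp [ρ]

/-- The new action is glued from three invariant pieces: representatives off `Y`, the prescribed
action on the reserved fibres `Q` whose code acts for `K`, and an extension through the shift on `Y
\ Q`. -/
theorem exists_le_mem (hi : MeasurableEmbedding i) (hi0 : μ (Set.range i) = 0)
    (hfm : ∀ a n, Measurable fun z => f z a n)
    (hf : ∀ (S : Set (AutMp μ)) (φ : AutMp μ → ℕ → ℕ), S.Countable → S.Nonempty →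
      ∃ z, (∀ a ∈ S, f z a = φ a) ∧ ∀ a ∉ S, f z a = fun _ => 0)
    (p : PartialLift μ f i) (a : AutMp μ) : ∃ q, p ≤ q ∧ a ∈ q.dom := by
  classical
  by_cases hap : a ∈ p.dom
  · exact ⟨p, le_rfl, hap⟩
  let G := p.dom
  let K : Subgroup (AutMp μ) := Subgroup.closure (insert a (G : Set (AutMp μ)))
  have hK : (K : Set (AutMp μ)).Countable :=
    Subgroup.countable_closure (p.countable_dom.insert a)
  have : Countable K := hK
  have hGK : G ≤ K := fun g hg => Subgroup.subset_closure (Set.mem_insert_of_mem a hg)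
  have haK : a ∈ K := Subgroup.subset_closure (Set.mem_insert a _)
  choose s hs using QuotientGroup.mk'_surjective (Imp μ)
  -- With the old lifts included, off `Y` the representatives both multiply exactly and agree with
  -- `p.lift` on `G`.
  let S : Subgroup (Gmp μ) := Subgroup.closure (s '' K ∪ p.lift '' G)
  have hS : (S : Set (Gmp μ)).Countable :=
    Subgroup.countable_closure ((hK.image s).union (p.countable_dom.image p.lift))
  have hsS : ∀ g ∈ K, s g ∈ S := fun g hg => Subgroup.subset_closure (Or.inl ⟨g, hg, rfl⟩)
  have hlS : ∀ g ∈ G, p.lift g ∈ S := fun g hg => Subgroup.subset_closure (Or.inr ⟨g, hg, rfl⟩)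
  obtain ⟨Y, hYm, hY0, hiY, hSY, hrel⟩ := exists_null_invariant hS hi.measurableSet_range hi0
  let Zact : Set FunCode := {z | IsActionOn (f z) K}
  have hZact : MeasurableSet Zact := measurableSet_isActionOn hfm hK
  let Q : Set X := i '' (Prod.fst ⁻¹' Zact)
  have hQm : MeasurableSet Q := hi.measurableSet_image' (measurable_fst hZact)
  have hQY : Q ⊆ Y := (Set.image_subset_range _ _).trans hiY
  have hiQ : ∀ w, i w ∈ Q ↔ IsActionOn (f w.1) K := fun w => hi.injective.mem_set_image
  have hlQ' : ∀ g ∈ G, ∀ x ∈ Q, (p.lift g : Equiv.Perm X) x ∈ Q := by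
    rintro g hg _ ⟨w, hw, rfl⟩
    rw [p.lift_reserve g hg w (hw.mono hGK)]
    exact (hiQ _).2 hw
  have hlQ : ∀ g ∈ G, ∀ x, (p.lift g : Equiv.Perm X) x ∈ Q → x ∈ Q := by
    intro g hg x hx
    have := hlQ' g⁻¹ (inv_mem hg) _ hx
    rw [← Equiv.Perm.mul_apply, ← Subgroup.coe_mul, ← p.lift_mul _ (inv_mem hg) _ hg,
      inv_mul_cancel, p.lift_one] at this
    exact this
  let Y' : Set X := Y \ Q
  -- The fibre over `z` lies in `Y \ Q` because `z` does not act for `K`; it carries the required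
  -- copy of the shift of `G`.
  obtain ⟨z, hzG, hzK, d, hdm, hdi, hd⟩ := exists_shift_copy (f := f) p.countable_dom hf
    (K := K) (fun h => hap (h haK))
  obtain ⟨c, hcm, hcY, hc1, hcmul, hcG⟩ := exists_extend_action_on
    (Subgroup.inclusion hGK) (Subgroup.inclusion_injective hGK) (hYm.diff hQm)
    (a := fun g => (p.lift g : Equiv.Perm X)) (fun g => (p.lift g).2.measurable)
    (fun g x hx => ⟨(hSY _ (hlS g g.2) x).2 hx.1, fun h => hx.2 (hlQ g g.2 x h)⟩)
    (fun x _ => by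
      rw [Subgroup.coe_one, p.lift_one]
      rfl)
    (fun g h x _ => by
      rw [Subgroup.coe_mul, p.lift_mul _ g.2 _ h.2]
      rfl)
    (u := fun t => i (z, d t))
    (hi.measurable.comp (measurable_const.prodMk hdm))
    (fun t t' h => hdi (Prod.ext_iff.1 (hi.injective h)).2)
    (fun t => ⟨hiY ⟨_, rfl⟩, fun h => hzK ((hiQ _).1 h)⟩)
    (fun g t => by
      rw [p.lift_reserve g g.2 _ hzG, hd]
      rfl)
  let q : AutMp μ → X → X := fun g x => i (prescribed f g (hi.invFun x))
  have hqm : ∀ g, Measurable (q g) := fun g =>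
    hi.measurable.comp ((measurable_prescribed hfm g).comp hi.measurable_invFun)
  have hqi : ∀ g w, q g (i w) = i (prescribed f g w) := fun g w => by
    simp only [q, hi.leftInverse_invFun w]
  let b : K → X → X := fun k x => if x ∈ Y' then c k x else if x ∈ Q then q k x else
    (s k : Equiv.Perm X) x
  have hbY : ∀ k, ∀ x ∈ Y', b k x = c k x := fun k x hx => if_pos hx
  have hbQ : ∀ k w, IsActionOn (f w.1) K → b k (i w) = i (prescribed f k w) := by
    intro k w hw
    have hwQ := (hiQ w).2 hw
    have : i w ∉ Y' := fun h => h.2 hwQ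
    simp only [b, this, hwQ, if_true, if_false, hqi]
  have hbs : ∀ k, ∀ x ∉ Y, b k x = (s k : Equiv.Perm X) x := by
    intro k x hx
    have h1 : x ∉ Y' := fun h => hx h.1
    have h2 : x ∉ Q := fun h => hx (hQY h)
    simp only [b, h1, h2, if_false]
  have hcases : ∀ x, x ∈ Y' ∨ (∃ w, IsActionOn (f w.1) K ∧ i w = x) ∨ x ∉ Y := by
    intro x
    by_cases hx : x ∈ Y
    · by_cases hxQ : x ∈ Q
      · exact Or.inr (Or.inl hxQ)
      · exact Or.inl ⟨hx, hxQ⟩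
    · exact Or.inr (Or.inr hx)
  have hbm : ∀ k, Measurable (b k) := fun k =>
    Measurable.ite (hYm.diff hQm) (hcm k) (Measurable.ite hQm (hqm k) (s k).2.measurable)
  have hb1 : ∀ x, b 1 x = x := by
    intro x
    rcases hcases x with hx | ⟨w, hw, rfl⟩ | hx
    · rw [hbY 1 x hx, hc1 x hx]
    · rw [hbQ 1 w hw]
      exact congrArg i (prescribed_one hw)
    · rw [hbs 1 x hx]
      exact hrel _ (hsS _ (one_mem K)) 1 (one_mem S) ((hs _).trans (map_one _).symm) x hx
  have hbmul : ∀ k l x, b (k * l) x = b k (b l x) := by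
    intro k l x
    rcases hcases x with hx | ⟨w, hw, rfl⟩ | hx
    · rw [hbY _ x hx, hbY l x hx, hbY k _ (hcY l x hx), hcmul k l x hx]
    · rw [hbQ _ w hw, hbQ l w hw, hbQ k (prescribed f l w) hw]
      exact congrArg i (prescribed_mul hw k.2 l.2)
    · rw [hbs _ x hx, hbs l x hx, hbs k _ (mt (hSY _ (hsS l l.2) x).1 hx)]
      refine hrel _ (hsS _ (k * l).2) (s k * s l) (mul_mem (hsS k k.2) (hsS l l.2)) ?_ x hx
      rw [map_mul]
      exact (hs _).trans (congrArg₂ (· * ·) (hs k) (hs l)).symm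
  -- Agreement with `s k` off the null set `Y` makes `b k` measure preserving and puts it in the
  -- right class.
  obtain ⟨lift, hlift, hlift'⟩ := exists_lift_of_action hbm hb1 hbmul fun k => by
    refine ⟨s k, hs k, ?_⟩
    filter_upwards [measure_eq_zero_iff_ae_notMem.1 hY0] with x hx
    exact hbs k x hx
  refine ⟨⟨K, hK, lift, ?_, fun g hg => hlift' ⟨g, hg⟩, ?_⟩, ⟨hGK, ?_⟩, haK⟩
  · intro g hg h hh
    refine Subtype.ext (Equiv.ext fun x => ?_)
    refine (hlift (⟨g, hg⟩ * ⟨h, hh⟩) x).trans ?_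
    rw [hbmul, ← hlift, ← hlift]
    rfl
  · intro g hg w hw
    exact (hlift ⟨g, hg⟩ _).trans (hbQ ⟨g, hg⟩ w hw)
  · intro g hg
    refine Subtype.ext (Equiv.ext fun x => ?_)
    refine (hlift ⟨g, hGK hg⟩ x).trans ?_
    rcases hcases x with hx | ⟨w, hw, rfl⟩ | hx
    · rw [hbY _ x hx]
      exact hcG ⟨g, hg⟩ x hx
    · rw [hbQ _ w hw]
      exact (p.lift_reserve g hg w (hw.mono hGK)).symm
    · rw [hbs _ x hx]
      exact hrel _ (hsS g (hGK hg)) _ (hlS g hg)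
        ((hs g).trans (p.quotientMap_lift g hg).symm) x hx

end PartialLift

/-! ### Assembling the splitting -/

/-- Under the continuum hypothesis, the identity automorphism of `Aut(X, μ)` splits over
the canonical homomorphism `G_mp(X, μ) → Aut(X, μ)`, for every standard non-atomic Borel
probability space `(X, μ)`. -/
theorem theorem1 (CH : Cardinal.aleph.{0} 1 = Cardinal.continuum.{0})
    {X : Type*} [MeasurableSpace X] [StandardBorelSpace X]
    (μ : MeasureTheory.Measure X) [MeasureTheory.IsProbabilityMeasure μ]
    [MeasureTheory.NullSingletonClass μ] :
    ∃ h : AutMp μ →* Gmp μ, (quotientMap μ).comp h = MonoidHom.id (AutMp μ) := by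
  have hA := mk_AutMp_le_continuum μ
  obtain ⟨f, hfm, hf⟩ := exists_parametrization hA
  obtain ⟨i, hi, hi0⟩ := exists_measurableEmbedding_null (Z := FunCode × (ℕ → ℕ → Bool)) μ
  have hA1 : Cardinal.mk (AutMp μ) ≤ Cardinal.aleph 1 := by
    have h := congrArg Cardinal.lift CH
    rw [Cardinal.lift_aleph, Cardinal.lift_continuum, Ordinal.lift_one] at h
    rwa [h]
  obtain ⟨F, hF, hmem⟩ := exists_chain_of_card_le_aleph_one (P := PartialLift μ f i) hA1
    (fun p => p.dom) (fun _ => PartialLift.bddAbove_of_isChain)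
    (PartialLift.exists_le_mem hi hi0 hfm hf)
  have hcompat : ∀ a b, a ∈ (F b).dom → (F b).lift a = (F a).lift a := by
    intro a b hab
    rcases hF a b with h | h
    · exact h.2 a (hmem a)
    · exact (h.2 a hab).symm
  have hmul : ∀ a b, ∃ c, a ∈ (F c).dom ∧ b ∈ (F c).dom := by
    intro a b
    rcases hF a b with h | h
    · exact ⟨b, h.1 (hmem a), hmem b⟩
    · exact ⟨a, hmem a, h.1 (hmem b)⟩
  -- Any two stages are comparable, so each value may be computed at one stage containing both
  -- factors.
  refine ⟨MonoidHom.mk' (fun a => (F a).lift a) fun a b => ?_, ?_⟩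
  · obtain ⟨c, ha, hb⟩ := hmul a b
    rw [← hcompat _ c ha, ← hcompat _ c hb, ← hcompat _ c (mul_mem ha hb),
      (F c).lift_mul a ha b hb]
  · refine MonoidHom.ext fun a => ?_
    exact (F a).quotientMap_lift a (hmem a)
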